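/- Let $R$ be a commutative ring with unit, let $A$ be a finitely generated commutative $R$-algebra, and let $F\colon A\to A$ be an endomorphism of $R$-algebras. Let $\mathrm{Id}(A)$ be the set of all proper ideals of $A$. Its constructible topology is the one induced by the product topology on $\{0,1\}^A$ when an ideal is identified with its characteristic function, and its Zariski topology is the one generated by the sets $\{I\in \mathrm{Id}(A) : a\notin I\}$, $a\in A$. Endow $\operatorname{Spec} A$ likewise with its constructible topology or with its Zariski topology. In each of these four cases, the self-map $f\colon I\mapsto F^{-1}(I)$ of $\mathrm{Id}(A)$, respectively of $\operatorname{Spec}A$, has topological entropy $$h_{\mathrm{top}}(f)=0 .$$ Here, for a self-map $f$ of a topological space $X$, $$h_{\mathrm{top}}(f)=\sup_{\mathfrak U}\ \lim_{n\to\infty}\frac1n\log N\bigl(\mathfrak U\vee f^{-1}\mathfrak U\vee\cdots\vee f^{-(n-1)}\mathfrak U\bigr)\in[0,+\infty],$$ where $\mathfrak U$ runs over all finite open covers of $X$, $\mathfrak U\vee\mathfrak V=\{U\cap V : U\in\mathfrak U,\ V\in\mathfrak V\}$, and $N(\mathfrak U)$ is the least number of members of $\mathfrak U$ needed to cover $X$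 (with $h_{\mathrm{top}}(f)=0$ if $X=\emptyset$). -/

import Mathlib

open Set Filter Topology

noncomputable section

namespace CoverEntropy

variable {X : Type*}

/-- The complexity `N(𝔘)` of a cover: the least number of members of `𝔘` that are needed
to cover `X`. -/
def complexity (U : Set (Set X)) : ℕ :=
  sInf {k : ℕ | ∃ V : Set (Set X), V ⊆ U ∧ V.Finite ∧ ⋃₀ V = univ ∧ V.ncard = k}

/-- The joint cover `𝔘 ∨ 𝔙 = {U ∩ V}`. -/
def join (U V : Set (Set X)) : Set (Set X) :=
  Set.image2 (fun s t => s ∩ t) U V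

/-- The cover `𝔘_n = 𝔘 ∨ f⁻¹ 𝔘 ∨ ⋯ ∨ f^{-(n-1)} 𝔘` (the trivial cover `{X}` for `n = 0`). -/
def iterJoin (f : X → X) (U : Set (Set X)) : ℕ → Set (Set X)
  | 0 => {univ}
  | n + 1 => join (iterJoin f U n) ((fun s => f^[n] ⁻¹' s) '' U)

/-- The entropy `h(f, 𝔘) = lim (1/n) log N(𝔘_n)` of `f` relative to a finite cover `𝔘`.
The limit exists, see `tendsto_coverEntropy`. -/
def coverEntropy (f : X → X) (U : Set (Set X)) : EReal :=
  limsup (fun n : ℕ => ((Real.log (complexity (iterJoin f U n)) / n : ℝ) : EReal)) atTop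

/-- `𝔘` is a finite cover of `X` by sets that are open for the topology `τ`. -/
def IsFiniteOpenCover (τ : TopologicalSpace X) (U : Set (Set X)) : Prop :=
  U.Finite ∧ ⋃₀ U = univ ∧ ∀ s ∈ U, IsOpen[τ] s

/-- The topological entropy of a self-map `f` of the topological space `(X, τ)`: the supremum of
`h(f, 𝔘)` over all finite open covers `𝔘` of `X`. (It is `0` if `X` is empty.) -/
def topologicalEntropy (τ : TopologicalSpace X) (f : X → X) : EReal :=
  ⨆ (U : Set (Set X)) (_ : IsFiniteOpenCover τ U), coverEntropy f U

/-! The limit that defines `h(f, 𝔘)` exists. -/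

theorem exists_subcover {U : Set (Set X)} (hf : U.Finite) (hU : ⋃₀ U = univ) :
    ∃ V ⊆ U, V.Finite ∧ ⋃₀ V = univ ∧ V.ncard = complexity U :=
  Nat.sInf_mem (s := {k : ℕ | ∃ V : Set (Set X), V ⊆ U ∧ V.Finite ∧ ⋃₀ V = univ ∧ V.ncard = k})
    ⟨_, U, subset_rfl, hf, hU, rfl⟩

theorem complexity_le {U V : Set (Set X)} (hVU : V ⊆ U) (hf : V.Finite) (hV : ⋃₀ V = univ) :
    complexity U ≤ V.ncard :=
  Nat.sInf_le ⟨V, hVU, hf, hV, rfl⟩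

theorem sUnion_join {U V : Set (Set X)} (hU : ⋃₀ U = univ) (hV : ⋃₀ V = univ) :
    ⋃₀ join U V = univ := by
  refine eq_univ_of_forall fun x => ?_
  obtain ⟨s, hs, hxs⟩ : x ∈ ⋃₀ U := hU ▸ mem_univ x
  obtain ⟨t, ht, hxt⟩ : x ∈ ⋃₀ V := hV ▸ mem_univ x
  exact ⟨s ∩ t, ⟨s, hs, t, ht, rfl⟩, hxs, hxt⟩

theorem sUnion_preimage (g : X → X) {U : Set (Set X)} (hU : ⋃₀ U = univ) :
    ⋃₀ ((fun s => g ⁻¹' s) '' U) = univ := by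
  refine eq_univ_of_forall fun x => ?_
  obtain ⟨s, hs, hxs⟩ : g x ∈ ⋃₀ U := hU ▸ mem_univ _
  exact ⟨_, ⟨s, hs, rfl⟩, hxs⟩

theorem iterJoin_finite_cover (f : X → X) {U : Set (Set X)} (hf : U.Finite) (hU : ⋃₀ U = univ)
    (n : ℕ) : (iterJoin f U n).Finite ∧ ⋃₀ iterJoin f U n = univ := by
  induction n with
  | zero => exact ⟨finite_singleton _, sUnion_singleton _⟩
  | succ n ih => exact ⟨ih.1.image2 _ (hf.image _), sUnion_join ih.2 (sUnion_preimage _ hU)⟩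

theorem iterJoin_add (f : X → X) (U : Set (Set X)) (m n : ℕ) :
    iterJoin f U (m + n) = join (iterJoin f U m) ((fun s => f^[m] ⁻¹' s) '' iterJoin f U n) := by
  induction n with
  | zero => simp [iterJoin, join]
  | succ n ih =>
    rw [← add_assoc, iterJoin, ih, iterJoin]
    unfold join
    rw [image_image2, image2_image_right, image2_image_right]
    simp only [preimage_inter]
    rw [image2_image_right]
    refine image2_assoc fun a b c => ?_
    rw [inter_assoc, ← preimage_comp, ← Function.iterate_add, add_comm n m]

theorem complexity_join_le {U V : Set (Set X)} (hfU : U.Finite) (hU : ⋃₀ U = univ)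
    (hfV : V.Finite) (hV : ⋃₀ V = univ) :
    complexity (join U V) ≤ complexity U * complexity V := by
  obtain ⟨U', hUU', hfU', hU', hcU⟩ := exists_subcover hfU hU
  obtain ⟨V', hVV', hfV', hV', hcV⟩ := exists_subcover hfV hV
  rw [← hcU, ← hcV, ← Set.ncard_prod]
  refine (complexity_le (image2_subset hUU' hVV') (hfU'.image2 _ hfV')
    (sUnion_join hU' hV')).trans ?_
  rw [← image_uncurry_prod]
  exact ncard_image_le (hfU'.prod hfV')

theorem complexity_preimage_le (g : X → X) {U : Set (Set X)} (hf : U.Finite)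
    (hU : ⋃₀ U = univ) : complexity ((fun s => g ⁻¹' s) '' U) ≤ complexity U := by
  obtain ⟨V, hVU, hfV, hV, hc⟩ := exists_subcover hf hU
  rw [← hc]
  exact (complexity_le (image_mono hVU) (hfV.image _) (sUnion_preimage g hV)).trans
    (ncard_image_le hfV)

theorem complexity_iterJoin_add_le (f : X → X) {U : Set (Set X)} (hf : U.Finite)
    (hU : ⋃₀ U = univ) (m n : ℕ) : complexity (iterJoin f U (m + n)) ≤
      complexity (iterJoin f U m) * complexity (iterJoin f U n) := by
  have hm := iterJoin_finite_cover f hf hU m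
  have hn := iterJoin_finite_cover f hf hU n
  rw [iterJoin_add]
  exact (complexity_join_le hm.1 hm.2 (hn.1.image _) (sUnion_preimage _ hn.2)).trans
    (Nat.mul_le_mul_left _ (complexity_preimage_le _ hn.1 hn.2))

theorem tendsto_coverEntropy (f : X → X) {U : Set (Set X)} (hf : U.Finite) (hU : ⋃₀ U = univ) :
    Tendsto (fun n : ℕ => ((Real.log (complexity (iterJoin f U n)) / n : ℝ) : EReal)) atTop
      (𝓝 (coverEntropy f U)) := by
  have hsub : Subadditive fun n : ℕ => Real.log (complexity (iterJoin f U n)) := by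
    intro m n
    have h := complexity_iterJoin_add_le f hf hU m n
    have hpos : ∀ k, 0 ≤ Real.log (complexity (iterJoin f U k)) := fun k =>
      Real.log_natCast_nonneg _
    rcases Nat.eq_zero_or_pos (complexity (iterJoin f U (m + n))) with h0 | h0
    · simpa [h0] using add_nonneg (hpos m) (hpos n)
    · have hmn : complexity (iterJoin f U m) * complexity (iterJoin f U n) ≠ 0 := by omega
      rw [← Real.log_mul (by exact_mod_cast left_ne_zero_of_mul hmn)
        (by exact_mod_cast right_ne_zero_of_mul hmn)]
      exact Real.log_le_log (by exact_mod_cast h0) (by exact_mod_cast h)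
  have hbdd : BddBelow (range fun n : ℕ => Real.log (complexity (iterJoin f U n)) / n) :=
    ⟨0, by rintro _ ⟨n, rfl⟩; exact div_nonneg (Real.log_natCast_nonneg _) n.cast_nonneg⟩
  have h := (continuous_coe_real_ereal.tendsto _).comp (hsub.tendsto_lim hbdd)
  have h' : coverEntropy f U = (hsub.lim : EReal) := h.limsup_eq
  rw [h']
  exact h

end CoverEntropy

namespace IdealSpace

/-- The ideal space `Id(A)`: the set of all proper ideals of `A`. -/
def Id (A : Type*) [CommRing A] : Type _ := {I : Ideal A // I ≠ ⊤}

variable {A : Type*} [CommRing A]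

open Classical in
/-- The characteristic function of an ideal, as an element of `{0,1}^A`. -/
def charFun (I : Ideal A) : A → Bool := fun a => decide (a ∈ I)

/-- The constructible topology on `Id(A)`: the topology induced by the product topology when
`Id(A)` is viewed as a subset of `{0,1}^A`. -/
@[reducible]
def constructible (A : Type*) [CommRing A] : TopologicalSpace (Id A) :=
  TopologicalSpace.induced (fun I => charFun I.1) inferInstance

/-- The Zariski topology on `Id(A)`, generated by the sets `{I | a ∉ I}` with `a ∈ A`. -/
@[reducible]
def zariski (A : Type*) [CommRing A] : TopologicalSpace (Id A) :=
  TopologicalSpace.generateFrom (Set.range fun a : A => {I : Id A | a ∉ I.1})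

/-- The self-map `I ↦ F⁻¹(I)` of `Id(A)` induced by a ring endomorphism `F` of `A`. -/
def comap (F : A →+* A) (I : Id A) : Id A := ⟨Ideal.comap F I.1, Ideal.comap_ne_top F I.2⟩

/-- The topology on `Spec A` induced by the product topology when `Spec A` is viewed as a subset
of `{0,1}^A`. -/
@[reducible]
def specConstructible (A : Type*) [CommRing A] : TopologicalSpace (PrimeSpectrum A) :=
  TopologicalSpace.induced (fun p => charFun p.asIdeal) inferInstance

/-- Mathlib's constructible topology on `Spec A` is the one induced by `{0,1}^A`. -/
theorem constructibleTopology_primeSpectrum (A : Type*) [CommRing A] :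
    constructibleTopology (PrimeSpectrum A) = specConstructible A := by
  have hf : ∀ a : A, (fun p : PrimeSpectrum A => charFun p.asIdeal a) ⁻¹' {false} =
      (PrimeSpectrum.basicOpen a : Set (PrimeSpectrum A)) := fun a => by ext p; simp [charFun]
  have ht : ∀ a : A, (fun p : PrimeSpectrum A => charFun p.asIdeal a) ⁻¹' {true} =
      (PrimeSpectrum.basicOpen a : Set (PrimeSpectrum A))ᶜ := fun a => by ext p; simp [charFun]
  have hcont : ∀ a : A, @Continuous _ _ (specConstructible A) _ fun p : PrimeSpectrum A => charFun p.asIdeal a :=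
    fun a => @Continuous.comp _ _ _ (specConstructible A) _ _ _ _ (continuous_apply a) continuous_induced_dom
  have key : ∀ s : Set (PrimeSpectrum A), IsOpen s → IsCompact s →
      IsOpen[specConstructible A] s ∧ IsOpen[specConstructible A] sᶜ := by
    intro s ho hc
    obtain ⟨t, hts⟩ := PrimeSpectrum.isCompact_isOpen_iff.1 ⟨hc, ho⟩
    have hs : s = ⋃ a ∈ t, (PrimeSpectrum.basicOpen a : Set (PrimeSpectrum A)) := by
      rw [← hts]
      ext p
      simp [PrimeSpectrum.mem_zeroLocus, Set.subset_def]
    rw [hs, compl_iUnion₂]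
    constructor
    · refine @isOpen_biUnion _ _ (specConstructible A) _ _ fun a _ => ?_
      rw [← hf]
      exact @Continuous.isOpen_preimage _ _ (specConstructible A) _ _ (hcont a) _ (isOpen_discrete _)
    · refine @Set.Finite.isOpen_biInter _ _ (specConstructible A) _ _ t.finite_toSet fun a _ => ?_
      rw [← ht]
      exact @Continuous.isOpen_preimage _ _ (specConstructible A) _ _ (hcont a) _ (isOpen_discrete _)
  apply le_antisymm
  · rw [specConstructible, ← continuous_iff_le_induced]
    refine @continuous_pi _ _ _ (constructibleTopology _) _ _ fun a => ?_
    have h1 : IsOpen[constructibleTopology _]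
        (PrimeSpectrum.basicOpen a : Set (PrimeSpectrum A)) :=
      (PrimeSpectrum.isCompact_basicOpen a).isOpen_constructibleTopology_of_isOpen
        (PrimeSpectrum.basicOpen a).isOpen
    have h2 : IsOpen[constructibleTopology _]
        (PrimeSpectrum.basicOpen a : Set (PrimeSpectrum A))ᶜ :=
      IsCompact.isOpen_constructibleTopology_of_isClosed
        (by simpa using PrimeSpectrum.isCompact_basicOpen a)
        (PrimeSpectrum.basicOpen a).isOpen.isClosed_compl
    refine (@continuous_discrete_rng _ _ (constructibleTopology _) _ _ _).2 fun b => ?_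
    cases b
    · rw [hf]; exact h1
    · rw [ht]; exact h2
  · refine le_generateFrom ?_
    rintro s (⟨ho, hc⟩ | ⟨hcl, hc⟩)
    · exact (key s ho hc).1
    · simpa using (key sᶜ hcl.isOpen_compl hc).2

end IdealSpace

end

/-! The constructible topology is compact, so a finite open cover is refined by the partition
according to membership of finitely many `s` in `A`. As `s ∈ f^k(I)` means `F^k s ∈ I`, the
complexity of the `n`-th join is at most the product over these `s` of the number of sets `{k < n :
F^k s ∈ I}`, with `I` an ideal (`coverEntropy_eq_zero_of_ideals`). It remains to see that each of
these counts is subexponential.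

Otherwise Sauer–Shelah counting (`tendsto_log_card_div_of_shatters`) yields, for infinitely many
`n`, shattered sets of times of density above a fixed `δ > 0`. For times in a shattered set, no `F^j
a` lies in the ideal generated by the others (`idealIndep_of_shatters`). Shifting and passing to a
limit gives an infinite set of such times (`exists_infinite_of_frequently_dense`). This is
impossible, because the orbit of `a` lies in a Noetherian subring generated by finitely many
elements (`exists_noetherian_subring_orbit`). -/

/-! ### Dense sets of times -/

/-- A set of naturals that meets some short interval sparsely at every position is sparse. -/
theorem card_filter_Ico_le_of_sparse {c : ℝ} {L : ℕ} {J : Finset ℕ}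
    (h : ∀ t, ∃ l, 1 ≤ l ∧ l ≤ L ∧ ((J.filter (· ∈ Finset.Ico t (t + l))).card : ℝ) ≤ c * l)
    (hc : 0 ≤ c) (m t : ℕ) :
    ((J.filter (· ∈ Finset.Ico t (t + m))).card : ℝ) ≤ c * m + L := by
  induction m using Nat.strong_induction_on generalizing t with
  | _ m ih =>
    -- A long window sheds a sparse block of length `l ≥ 1` and recurses; the error `L` is paid
    -- once, for the last short window.
    rcases le_or_gt m L with hm | hm
    · have h1 : (J.filter (· ∈ Finset.Ico t (t + m))).card ≤ (Finset.Ico t (t + m)).card :=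
        Finset.card_le_card fun x hx => (Finset.mem_filter.1 hx).2
      rw [Nat.card_Ico, Nat.add_sub_cancel_left] at h1
      have h2 : ((J.filter (· ∈ Finset.Ico t (t + m))).card : ℝ) ≤ L := by
        exact_mod_cast h1.trans hm
      have : 0 ≤ c * m := by positivity
      linarith
    · obtain ⟨l, hl1, hlL, hl⟩ := h t
      have hsub : J.filter (· ∈ Finset.Ico t (t + m)) ⊆
          J.filter (· ∈ Finset.Ico t (t + l)) ∪
            J.filter (· ∈ Finset.Ico (t + l) (t + l + (m - l))) := by
        intro x
        simp only [Finset.mem_filter, Finset.mem_union, Finset.mem_Ico]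
        rintro ⟨hx, h1, h2⟩
        rcases lt_or_ge x (t + l) with h3 | h3
        · exact Or.inl ⟨hx, h1, h3⟩
        · exact Or.inr ⟨hx, h3, by omega⟩
      have hcard : ((J.filter (· ∈ Finset.Ico t (t + m))).card : ℝ) ≤
          (J.filter (· ∈ Finset.Ico t (t + l))).card +
            (J.filter (· ∈ Finset.Ico (t + l) (t + l + (m - l)))).card := by
        exact_mod_cast (Finset.card_le_card hsub).trans (Finset.card_union_le _ _)
      have hrec := ih (m - l) (by omega) (t + l)
      rw [Nat.cast_sub (by omega)] at hrec
      linarith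

/-- A family of finite subsets of `ℕ` that is closed under subsets and under left shifts, and
whose members fill a positive proportion of arbitrarily long initial segments, contains all
finite subsets of some infinite set. -/
theorem exists_infinite_of_frequently_dense {P : Finset ℕ → Prop}
    (hmono : ∀ I J, I ⊆ J → P J → P I) (hshift : ∀ t J, P (J.image (· + t)) → P J)
    {δ : ℝ} (hδ : 0 < δ)
    (hfreq : ∃ᶠ n : ℕ in atTop, ∃ J ⊆ Finset.range n, P J ∧ δ * n < J.card) :
    ∃ J : Set ℕ, J.Infinite ∧ ∀ I : Finset ℕ, ↑I ⊆ J → P I := by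
  have hfin : ∀ L : ℕ, ∃ J : Finset ℕ, P J ∧ ∀ l, 1 ≤ l → l ≤ L →
      δ / 2 * l < (J.filter (· < l)).card := by
    intro L
    obtain ⟨n, ⟨J, hJn, hPJ, hJ⟩, hn⟩ :=
      (hfreq.and_eventually (eventually_ge_atTop ⌈2 * L / δ⌉₊)).exists
    obtain ⟨t, ht⟩ : ∃ t, ∀ l, 1 ≤ l → l ≤ L →
        δ / 2 * l < (J.filter (· ∈ Finset.Ico t (t + l))).card := by
      -- Otherwise `J` would have at most `δ / 2 * n + L` elements, and `n ≥ 2 * L / δ` makes this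
      -- at most `δ * n`.
      by_contra! hcon
      have h1 := card_filter_Ico_le_of_sparse hcon (by positivity) n 0
      rw [Finset.filter_true_of_mem fun x hx => by simpa using hJn hx] at h1
      have h2 : 2 * L / δ ≤ n := Nat.ceil_le.1 hn
      rw [div_le_iff₀ hδ] at h2
      linarith
    refine ⟨(Finset.range L).filter (· + t ∈ J), hshift t _ (hmono _ _ ?_ hPJ),
      fun l hl1 hlL => (ht l hl1 hlL).trans_le ?_⟩
    · intro x hx
      obtain ⟨y, hy, rfl⟩ := Finset.mem_image.1 hx
      exact (Finset.mem_filter.1 hy).2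
    · refine Nat.cast_le.2 (le_trans (Finset.card_le_card ?_) (Finset.card_image_le (f := (· + t))))
      intro x
      simp only [Finset.mem_filter, Finset.mem_Ico, Finset.mem_image, Finset.mem_range]
      rintro ⟨hx, h1, h2⟩
      exact ⟨x - t, ⟨⟨by omega, by rwa [Nat.sub_add_cancel h1]⟩, by omega⟩, by omega⟩
  choose J hPJ hJ using hfin
  -- The limit of the `J L` along a nonprincipal ultrafilter. If it were finite, then for suitable
  -- large `L` the set `J L` would have too few elements below `l`.
  refine ⟨{k | ∀ᶠ L in (hyperfilter ℕ : Filter ℕ), k ∈ J L}, fun hJfin => ?_, fun I hI => ?_⟩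
  · obtain ⟨l, hl⟩ := exists_nat_gt (hJfin.toFinset.card / (δ / 2))
    have hl1 : 1 ≤ l := by
      by_contra! h0
      have h1 : (l : ℝ) ≤ 0 := by exact_mod_cast Nat.lt_one_iff.1 h0 |>.le
      have h2 : 0 ≤ hJfin.toFinset.card / (δ / 2) := by positivity
      linarith
    rw [div_lt_iff₀ (by positivity)] at hl
    have hev : ∀ᶠ L in (hyperfilter ℕ : Filter ℕ), ∀ k ∈ Finset.range l,
        k ∈ J L → k ∈ hJfin.toFinset := by
      refine (eventually_all_finset _).2 fun k _ => ?_
      by_cases hk : ∀ᶠ L in (hyperfilter ℕ : Filter ℕ), k ∈ J L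
      · exact Eventually.of_forall fun _ _ => by simpa using hk
      · exact (Ultrafilter.eventually_not.2 hk).mono fun L h h' => absurd h' h
    have hge : ∀ᶠ L in (hyperfilter ℕ : Filter ℕ), l ≤ L :=
      (Nat.hyperfilter_le_atTop : (hyperfilter ℕ : Filter ℕ) ≤ atTop) (eventually_ge_atTop l)
    obtain ⟨L, h1, h2⟩ := (hev.and hge).exists
    have h3 : ((J L).filter (· < l)).card ≤ hJfin.toFinset.card :=
      Finset.card_le_card fun x hx => by
        rw [Finset.mem_filter] at hx
        exact h1 x (Finset.mem_range.2 hx.2) hx.1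
    have h4 := hJ L l hl1 h2
    have h5 : (((J L).filter (· < l)).card : ℝ) ≤ hJfin.toFinset.card := by exact_mod_cast h3
    linarith
  · obtain ⟨L, hL⟩ := ((eventually_all_finset I).2 fun k hk => hI hk).exists
    exact hmono _ _ hL (hPJ L)

/-! ### Sauer–Shelah counting -/

/-- If all sets shattered by `𝒜` have at most `d` elements, then `#𝒜 ≤ (1 + x) ^ n / x ^ d`. -/
theorem card_mul_pow_le_of_shatters {n : ℕ} {𝒜 : Finset (Finset ℕ)}
    (h𝒜 : ∀ s ∈ 𝒜, s ⊆ Finset.range n) {d : ℕ} (hd : ∀ s, 𝒜.Shatters s → s.card ≤ d)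
    {x : ℝ} (hx : 0 < x) (hx1 : x ≤ 1) : 𝒜.card * x ^ d ≤ (1 + x) ^ n := by
  have hsub : 𝒜.shatterer ⊆ (Finset.range n).powerset := by
    intro s hs
    obtain ⟨t, ht, hst⟩ := (Finset.mem_shatterer.1 hs).exists_superset
    exact Finset.mem_powerset.2 (hst.trans (h𝒜 t ht))
  -- A family shatters at least as many sets as it has members; each shattered set has weight at
  -- least `x ^ d`.
  calc (𝒜.card : ℝ) * x ^ d ≤ 𝒜.shatterer.card * x ^ d := by
        have : (𝒜.card : ℝ) ≤ 𝒜.shatterer.card := by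
          exact_mod_cast Finset.card_le_card_shatterer 𝒜
        exact mul_le_mul_of_nonneg_right this (by positivity)
    _ = ∑ _s ∈ 𝒜.shatterer, x ^ d := by rw [Finset.sum_const, nsmul_eq_mul]
    _ ≤ ∑ s ∈ 𝒜.shatterer, x ^ s.card := Finset.sum_le_sum fun s hs =>
        pow_le_pow_of_le_one hx.le hx1 (hd s (Finset.mem_shatterer.1 hs))
    _ ≤ ∑ s ∈ (Finset.range n).powerset, x ^ s.card :=
        Finset.sum_le_sum_of_subset_of_nonneg hsub fun _ _ _ => by positivity
    _ = (1 + x) ^ n := by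
        have := Finset.prod_one_add (f := fun _ : ℕ => x) (Finset.range n)
        simpa using this.symm

/-- Set families in which the shattered sets have sublinear size grow subexponentially. -/
theorem tendsto_log_card_div_of_shatters {𝒜 : ℕ → Finset (Finset ℕ)}
    (h𝒜 : ∀ n, ∀ s ∈ 𝒜 n, s ⊆ Finset.range n)
    (hd : ∀ δ : ℝ, 0 < δ → ∀ᶠ n : ℕ in atTop, ∀ s, (𝒜 n).Shatters s → (s.card : ℝ) ≤ δ * n) :
    Tendsto (fun n : ℕ => Real.log (𝒜 n).card / n) atTop (𝓝 0) := by
  rw [Metric.tendsto_atTop']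
  intro ε hε
  obtain ⟨x, hx, hx1, hxε⟩ : ∃ x : ℝ, 0 < x ∧ x < 1 ∧ x < ε / 2 :=
    ⟨min (1 / 2) (ε / 4), by positivity, by
      linarith [min_le_left (1 / 2 : ℝ) (ε / 4)], by linarith [min_le_right (1 / 2 : ℝ) (ε / 4)]⟩
  have hlog : Real.log x < 0 := Real.log_neg hx hx1
  -- This density makes `-d * log x` at most `ε / 4 * n`; with `n * log (1 + x) ≤ ε / 2 * n` the
  -- total stays below `ε * n`.
  obtain ⟨N, hN⟩ := eventually_atTop.1
    (hd (ε / 4 / -Real.log x) (div_pos (by positivity) (by linarith)))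
  refine ⟨N, fun n hn => ?_⟩
  have hpos : 0 ≤ Real.log (𝒜 n).card / n := div_nonneg (Real.log_natCast_nonneg _) n.cast_nonneg
  rw [Real.dist_eq, sub_zero, abs_of_nonneg hpos]
  have hn0 : (0 : ℝ) < n := by exact_mod_cast Nat.zero_lt_of_lt hn
  rw [div_lt_iff₀ hn0]
  rcases Nat.eq_zero_or_pos (𝒜 n).card with h0 | h0
  · rw [h0, Nat.cast_zero, Real.log_zero]
    positivity
  have hcard : (0 : ℝ) < (𝒜 n).card := by exact_mod_cast h0
  set d := ⌊ε / 4 / -Real.log x * n⌋₊ with hd_def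
  have hfl : (d : ℝ) ≤ ε / 4 / -Real.log x * n :=
    Nat.floor_le (mul_nonneg (div_nonneg (by positivity) (by linarith)) hn0.le)
  have hle := card_mul_pow_le_of_shatters (h𝒜 n)
    (fun s hs => Nat.le_floor (hN n hn.le s hs)) hx hx1.le
  rw [← hd_def] at hle
  have hle' := Real.log_le_log (by positivity) hle
  rw [Real.log_mul hcard.ne' (by positivity), Real.log_pow, Real.log_pow] at hle'
  have h1 : Real.log (1 + x) ≤ x := by
    have := Real.log_le_sub_one_of_pos (show 0 < 1 + x by linarith)
    linarith
  have h2 : (n : ℝ) * Real.log (1 + x) ≤ n * x := by gcongr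
  have h3 : (d : ℝ) * -Real.log x ≤ ε / 4 * n := by
    calc (d : ℝ) * -Real.log x ≤ ε / 4 / -Real.log x * n * -Real.log x :=
          mul_le_mul_of_nonneg_right hfl (by linarith)
      _ = ε / 4 * n := by
          have : Real.log x ≠ 0 := hlog.ne
          field_simp
  have h4 : (n : ℝ) * x ≤ n * (ε / 2) := by gcongr
  have h5 : 0 < ε * n := by positivity
  linarith

/-! ### Ideal independence and Noetherian subrings -/

/-- No `b j` with `j ∈ J` lies in the ideal generated by the other `b i`, `i ∈ J`. -/
def IdealIndep {A : Type*} [CommRing A] (b : ℕ → A) (J : Set ℕ) : Prop :=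
  ∀ j ∈ J, b j ∉ Ideal.span (b '' (J \ {j}))

theorem IdealIndep.mono {A : Type*} [CommRing A] {b : ℕ → A} {I J : Set ℕ} (hJ : IdealIndep b J)
    (h : I ⊆ J) : IdealIndep b I := fun j hj hmem =>
  hJ j (h hj) (Ideal.span_mono (image_mono (sdiff_subset_sdiff_left h)) hmem)

/-- Applying `F^t` to a dependence relation among the `F^k a` yields one among the `F^(k+t) a`. -/
theorem IdealIndep.of_shift {A : Type*} [CommRing A] (F : A →+* A) (a : A) (t : ℕ) {J : Set ℕ}
    (hJ : IdealIndep (fun k => F^[k] a) ((· + t) '' J)) : IdealIndep (fun k => F^[k] a) J := by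
  intro j hj hmem
  refine hJ (j + t) ⟨j, hj, rfl⟩ ?_
  have h := Ideal.mem_map_of_mem (F ^ t) hmem
  rw [Ideal.map_span, RingHom.coe_pow, ← Function.iterate_add_apply, add_comm t j] at h
  refine Ideal.span_mono ?_ h
  rintro _ ⟨_, ⟨i, hi, rfl⟩, rfl⟩
  refine ⟨i + t, ⟨⟨i, hi.1, rfl⟩, fun h => hi.2 (Nat.add_right_cancel h)⟩, ?_⟩
  simp only [← Function.iterate_add_apply, add_comm]

/-- A sequence in a Noetherian subring has no infinite independent subsequence. -/
theorem not_infinite_of_idealIndep {A : Type*} [CommRing A] {b : ℕ → A} (B : Subring A)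
    [IsNoetherianRing B] (hb : ∀ k, b k ∈ B) {J : Set ℕ} (hJ : J.Infinite) :
    ¬ IdealIndep b J := by
  classical
  intro hind
  let b' : ℕ → B := fun k => ⟨b k, hb k⟩
  obtain ⟨s, hs, hspan⟩ := (Submodule.fg_span_iff_fg_span_finset_subset (R := B) (b' '' J)).1
    (IsNoetherian.noetherian _)
  obtain ⟨T, hTJ, rfl⟩ := Finset.subset_set_image_iff.1 hs
  obtain ⟨j, hj, hjT⟩ := hJ.exists_notMem_finset T
  have h1 : b' j ∈ Ideal.span (b' '' (T : Set ℕ)) := by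
    have : b' j ∈ Submodule.span B (b' '' J) := Submodule.subset_span ⟨j, hj, rfl⟩
    rw [hspan] at this
    simpa using this
  -- A relation with coefficients in `B` is also one over `A`, so `A` itself need not be Noetherian.
  have h2 := Ideal.mem_map_of_mem B.subtype h1
  rw [Ideal.map_span, ← image_comp] at h2
  refine hind j hj (Ideal.span_mono (image_mono ?_) h2)
  exact fun i hi => ⟨hTJ hi, fun h => hjT (h ▸ hi)⟩

/-- A polynomial expression involves only finitely many scalars. -/
theorem exists_finset_mem_adjoin_int {R A : Type*} [CommRing R] [CommRing A] [Algebra R A]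
    {s : Set A} {a : A} (ha : a ∈ Algebra.adjoin R s) :
    ∃ T : Finset R, a ∈ Algebra.adjoin ℤ (s ∪ algebraMap R A '' T) := by
  classical
  have hmono : ∀ {T T' : Finset R}, T ⊆ T' →
      Algebra.adjoin ℤ (s ∪ algebraMap R A '' T) ≤ Algebra.adjoin ℤ (s ∪ algebraMap R A '' T') :=
    fun h => Algebra.adjoin_mono (union_subset_union_right _ (image_mono (by exact_mod_cast h)))
  induction ha using Algebra.adjoin_induction with
  | mem x hx => exact ⟨∅, Algebra.subset_adjoin (Or.inl hx)⟩
  | algebraMap r => exact ⟨{r}, Algebra.subset_adjoin (Or.inr ⟨r, by simp, rfl⟩)⟩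
  | add x y _ _ hx hy =>
    obtain ⟨T, hT⟩ := hx
    obtain ⟨T', hT'⟩ := hy
    exact ⟨T ∪ T', add_mem (hmono Finset.subset_union_left hT)
      (hmono Finset.subset_union_right hT')⟩
  | mul x y _ _ hx hy =>
    obtain ⟨T, hT⟩ := hx
    obtain ⟨T', hT'⟩ := hy
    exact ⟨T ∪ T', mul_mem (hmono Finset.subset_union_left hT)
      (hmono Finset.subset_union_right hT')⟩

/-- Every orbit of an endomorphism of a finitely generated algebra lies in a Noetherian subring. -/
theorem exists_noetherian_subring_orbit {R A : Type*} [CommRing R] [CommRing A] [Algebra R A]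
    [Algebra.FiniteType R A] (F : A →ₐ[R] A) (a : A) :
    ∃ B : Subring A, IsNoetherianRing B ∧ ∀ k, F^[k] a ∈ B := by
  classical
  obtain ⟨s, hs⟩ := Algebra.FiniteType.out (R := R) (A := A)
  have hmem : ∀ x : A, ∃ T : Finset R, x ∈ Algebra.adjoin ℤ (↑s ∪ algebraMap R A '' T) :=
    fun x => exists_finset_mem_adjoin_int (hs ▸ Algebra.mem_top)
  choose T hT using hmem
  -- All scalars needed to write `a` and the `F x`, `x ∈ s`, over `ℤ`. Since `F` fixes scalars, the
  -- ring `ℤ[G]` is stable under `F`.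
  let C : Finset R := (insert a (s.image F)).biUnion T
  let G : Finset A := s ∪ C.image (algebraMap R A)
  have hle : ∀ x ∈ insert a (s.image F), x ∈ Algebra.adjoin ℤ (G : Set A) := by
    intro x hx
    refine Algebra.adjoin_mono ?_ (hT x)
    simp only [G, Finset.coe_union, Finset.coe_image]
    refine union_subset_union_right _ (image_mono ?_)
    exact_mod_cast Finset.subset_biUnion_of_mem T hx
  have hF : ∀ x ∈ Algebra.adjoin ℤ (G : Set A), F x ∈ Algebra.adjoin ℤ (G : Set A) := by
    intro x hx
    induction hx using Algebra.adjoin_induction with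
    | mem x hx =>
      rcases Finset.mem_union.1 (Finset.mem_coe.1 hx) with h | h
      · exact hle _ (Finset.mem_insert_of_mem (Finset.mem_image_of_mem F h))
      · obtain ⟨r, hr, rfl⟩ := Finset.mem_image.1 h
        rw [AlgHom.commutes]
        exact Algebra.subset_adjoin hx
    | algebraMap r => simp
    | add x y _ _ hx hy => rw [map_add]; exact add_mem hx hy
    | mul x y _ _ hx hy => rw [map_mul]; exact mul_mem hx hy
  refine ⟨(Algebra.adjoin ℤ (G : Set A)).toSubring, ?_, fun k => ?_⟩
  · have : Algebra.FiniteType ℤ (Algebra.adjoin ℤ (G : Set A)) :=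
      (Subalgebra.fg_iff_finiteType _).1 ⟨G, rfl⟩
    exact Algebra.FiniteType.isNoetherianRing ℤ (Algebra.adjoin ℤ (G : Set A))
  · induction k with
    | zero => exact hle a (Finset.mem_insert_self _ _)
    | succ k ih => rw [Function.iterate_succ_apply']; exact hF _ ih

/-! ### Visit patterns of an orbit -/

open Classical in
/-- The sets of times `k < n` at which the orbit of `a` visits an ideal. -/
noncomputable def visitPatterns {A : Type*} [CommRing A] (F : A →+* A) (a : A) (n : ℕ) :
    Finset (Finset ℕ) :=
  (Finset.range n).powerset.filter fun u =>
    ∃ I : Ideal A, u = (Finset.range n).filter (F^[·] a ∈ I)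

theorem subset_range_of_mem_visitPatterns {A : Type*} [CommRing A] {F : A →+* A} {a : A} {n : ℕ}
    {u : Finset ℕ} (hu : u ∈ visitPatterns F a n) : u ⊆ Finset.range n := by
  classical
  exact Finset.mem_powerset.1 (Finset.mem_filter.1 hu).1

/-- Shattering supplies an ideal containing `F^i a` for all `i ∈ J` except `i = j`; a dependence
relation would force `F^j a` into it too. -/
theorem idealIndep_of_shatters {A : Type*} [CommRing A] {F : A →+* A} {a : A} {n : ℕ}
    {J : Finset ℕ} (hJ : (visitPatterns F a n).Shatters J) :
    IdealIndep (fun k => F^[k] a) (J : Set ℕ) := by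
  classical
  intro j hj hmem
  obtain ⟨u, hu, hJu⟩ := hJ (Finset.erase_subset j J)
  obtain ⟨v, hv, hJv⟩ := hJ.exists_superset
  have hJn : J ⊆ Finset.range n :=
    hJv.trans (subset_range_of_mem_visitPatterns hv)
  obtain ⟨-, I, rfl⟩ := Finset.mem_filter.1 hu
  have hle : Ideal.span ((fun k => F^[k] a) '' ((J : Set ℕ) \ {j})) ≤ I := by
    rw [Ideal.span_le]
    rintro _ ⟨i, hi, rfl⟩
    have : i ∈ J.erase j := Finset.mem_erase.2 ⟨hi.2, hi.1⟩
    rw [← hJu] at this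
    exact (Finset.mem_filter.1 (Finset.mem_inter.1 this).2).2
  have : j ∈ J.erase j := by
    rw [← hJu]
    exact Finset.mem_inter.2 ⟨hj, Finset.mem_filter.2 ⟨hJn hj, hle hmem⟩⟩
  exact Finset.notMem_erase j J this

theorem tendsto_log_card_visitPatterns {R A : Type*} [CommRing R] [CommRing A] [Algebra R A]
    [Algebra.FiniteType R A] (F : A →ₐ[R] A) (a : A) :
    Tendsto (fun n : ℕ => Real.log (visitPatterns (F : A →+* A) a n).card / n) atTop (𝓝 0) := by
  refine tendsto_log_card_div_of_shatters
    (fun n s hs => subset_range_of_mem_visitPatterns hs) fun δ hδ => ?_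
  by_contra hcon
  obtain ⟨B, _, hB⟩ := exists_noetherian_subring_orbit F a
  obtain ⟨J, hJ, hfin⟩ := exists_infinite_of_frequently_dense
    (P := fun J : Finset ℕ => IdealIndep (fun k => (F : A →+* A)^[k] a) (J : Set ℕ))
    (fun I J hIJ hJ => hJ.mono (by exact_mod_cast hIJ))
    (fun t J hJ => IdealIndep.of_shift (F : A →+* A) a t (by simpa using hJ)) hδ <| by
      refine (not_eventually.1 hcon).mono fun n hn => ?_
      push Not at hn
      obtain ⟨s, hs, hcard⟩ := hn
      obtain ⟨v, hv, hsv⟩ := hs.exists_superset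
      exact ⟨s, hsv.trans (subset_range_of_mem_visitPatterns hv),
        idealIndep_of_shatters hs, hcard⟩
  -- Independence of all finite subsets of `J` gives that of `J`, as membership in a span uses
  -- finitely many generators.
  refine not_infinite_of_idealIndep B (b := fun k => F^[k] a) hB hJ fun j hj hmem => ?_
  obtain ⟨s, hs, hspan⟩ := Submodule.mem_span_finite_of_mem_span hmem
  obtain ⟨T, hTJ, rfl⟩ := by classical exact Finset.subset_set_image_iff.1 hs
  classical
  refine hfin (insert j T) ?_ j (by simp) (Ideal.span_mono ?_ hspan)
  · rw [Finset.coe_insert]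
    exact insert_subset hj (hTJ.trans sdiff_subset)
  · rw [Finset.coe_image]
    exact image_mono fun i hi => ⟨by simp [Finset.mem_coe.1 hi], (hTJ hi).2⟩

/-! ### From covers to visit patterns -/

namespace CoverEntropy

theorem coverEntropy_nonneg {X : Type*} (f : X → X) (U : Set (Set X)) : 0 ≤ coverEntropy f U :=
  le_limsup_of_frequently_le (Frequently.of_forall fun n => by
    exact_mod_cast div_nonneg (Real.log_natCast_nonneg _) n.cast_nonneg)

theorem topologicalEntropy_eq_zero {X : Type*} {τ : TopologicalSpace X} {f : X → X}
    (h : ∀ U, IsFiniteOpenCover τ U → coverEntropy f U = 0) : topologicalEntropy τ f = 0 := by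
  refine le_antisymm (iSup₂_le fun U hU => (h U hU).le) ?_
  -- An empty supremum in `EReal` is `⊥`, so the lower bound needs an actual cover.
  refine (coverEntropy_nonneg f {univ}).trans
    (le_iSup₂ (f := fun U (_ : IsFiniteOpenCover τ U) => coverEntropy f U) {univ} ?_)
  exact ⟨finite_singleton _, sUnion_singleton _, by rintro s rfl; exact isOpen_univ⟩

theorem IsFiniteOpenCover.mono {X : Type*} {τ τ' : TopologicalSpace X} {U : Set (Set X)}
    (hU : IsFiniteOpenCover τ U) (h : τ' ≤ τ) : IsFiniteOpenCover τ' U :=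
  ⟨hU.1, hU.2.1, fun s hs => h s (hU.2.2 s hs)⟩

/-- An open cover of a compact space with the topology induced by `{0,1}^A` is refined by the
partition according to finitely many coordinates. -/
theorem exists_finset_coordinates {X A : Type*} (φ : X → A → Bool)
    (hc : @CompactSpace X (TopologicalSpace.induced φ inferInstance)) {U : Set (Set X)}
    (hU : IsFiniteOpenCover (TopologicalSpace.induced φ inferInstance) U) :
    ∃ S : Finset A, ∀ x, ∃ u ∈ U, ∀ y, (∀ s ∈ S, φ y s = φ x s) → y ∈ u := by
  classical
  let _ : TopologicalSpace X := TopologicalSpace.induced φ inferInstance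
  have hφ : Continuous φ := continuous_induced_dom
  have hloc : ∀ x, ∃ S : Finset A, ∃ u ∈ U, ∀ y, (∀ s ∈ S, φ y s = φ x s) → y ∈ u := by
    intro x
    obtain ⟨u, hu, hxu⟩ : x ∈ ⋃₀ U := hU.2.1 ▸ mem_univ x
    obtain ⟨v, hv, rfl⟩ := isOpen_induced_iff.1 (hU.2.2 u hu)
    obtain ⟨S, w, hw, hwv⟩ := isOpen_pi_iff.1 hv (φ x) hxu
    refine ⟨S, _, hu, fun y hy => hwv fun s hs => ?_⟩
    rw [hy s hs]
    exact (hw s hs).2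
  choose S u hu hS using hloc
  obtain ⟨T, hT⟩ := isCompact_univ.elim_nhds_subcover
    (fun x => {y | ∀ s ∈ S x, φ y s = φ x s}) fun x _ => by
      refine IsOpen.mem_nhds ?_ fun s _ => rfl
      have : {y | ∀ s ∈ S x, φ y s = φ x s} = ⋂ s ∈ S x, (fun y => φ y s) ⁻¹' {φ x s} := by
        ext y; simp
      rw [this]
      exact isOpen_biInter_finset fun s _ =>
        (isOpen_discrete _).preimage ((continuous_apply s).comp hφ)
  -- A point agreeing with `x` on all these coordinates lies in the same cylinder of the finite
  -- subcover as `x`.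
  refine ⟨T.biUnion S, fun x => ?_⟩
  obtain ⟨t, ht, hxt⟩ := mem_iUnion₂.1 (hT.2 (mem_univ x))
  refine ⟨u t, hu t, fun y hy => hS t y fun s hs => ?_⟩
  exact (hy s (Finset.mem_biUnion.2 ⟨t, ht, hs⟩)).trans (hxt s hs)

/-- Each nonempty fibre of `π` lies in one member of `U`, so one member per value suffices. -/
theorem complexity_le_card_of_refines {X P : Type*} {U : Set (Set X)} (π : X → P) {T : Finset P}
    (hT : ∀ x, π x ∈ T) (hπ : ∀ x, ∃ u ∈ U, ∀ y, π y = π x → y ∈ u) :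
    complexity U ≤ T.card := by
  choose u hu hmem using hπ
  have hfin : (range π).Finite := T.finite_toSet.subset (range_subset_iff.2 hT)
  let g : range π → Set X := fun p => u p.2.choose
  have : Finite (range π) := hfin
  refine (complexity_le (V := range g) ?_ (finite_range g) ?_).trans ?_
  · rintro _ ⟨p, rfl⟩
    exact hu _
  · refine eq_univ_of_forall fun x => ⟨_, ⟨⟨π x, x, rfl⟩, rfl⟩, hmem _ _ ?_⟩
    exact (mem_range_self (f := π) x).choose_spec.symm
  · calc (range g).ncard = (g '' univ).ncard := by rw [image_univ]
      _ ≤ (univ : Set (range π)).ncard := ncard_image_le finite_univ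
      _ = (range π).ncard := by rw [ncard_univ, Nat.card_coe_set_eq]
      _ ≤ (T : Set P).ncard := ncard_le_ncard (range_subset_iff.2 hT) T.finite_toSet
      _ = T.card := ncard_coe_finset T

/-- If `X` maps equivariantly to the ideals of `A`, and the topology of `X` is compact and induced
by the constructible topology, then every finite open cover of `X` has zero entropy. -/
theorem coverEntropy_eq_zero_of_ideals {R A : Type*} [CommRing R] [CommRing A] [Algebra R A]
    [Algebra.FiniteType R A] (F : A →ₐ[R] A) {X : Type*} (ι : X → Ideal A) (f : X → X)
    (hf : ∀ x, ι (f x) = Ideal.comap (F : A →+* A) (ι x))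
    (hc : @CompactSpace X
      (TopologicalSpace.induced (fun x => IdealSpace.charFun (ι x)) inferInstance))
    {U : Set (Set X)} (hU : IsFiniteOpenCover
      (TopologicalSpace.induced (fun x => IdealSpace.charFun (ι x)) inferInstance) U) :
    coverEntropy f U = 0 := by
  classical
  obtain ⟨S, hS⟩ := exists_finset_coordinates _ hc hU
  have hiter : ∀ n x a, a ∈ ι (f^[n] x) ↔ (F : A →+* A)^[n] a ∈ ι x := by
    intro n
    induction n with
    | zero => exact fun _ _ => Iff.rfl
    | succ n ih =>
      intro x a
      rw [Function.iterate_succ_apply, ih, hf, Ideal.mem_comap,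
        Function.iterate_succ_apply' (F : A →+* A)]
  have hjoin : ∀ n x, ∃ u ∈ iterJoin f U n, ∀ y,
      (∀ k < n, ∀ s ∈ S, ((F : A →+* A)^[k] s ∈ ι y ↔ (F : A →+* A)^[k] s ∈ ι x)) → y ∈ u := by
    intro n
    induction n with
    | zero => exact fun x => ⟨univ, rfl, fun _ _ => mem_univ _⟩
    | succ n ih =>
      intro x
      obtain ⟨u, hu, hux⟩ := ih x
      obtain ⟨v, hv, hvx⟩ := hS (f^[n] x)
      refine ⟨u ∩ f^[n] ⁻¹' v, ⟨u, hu, _, ⟨v, hv, rfl⟩, rfl⟩, fun y hy =>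
        ⟨hux y fun k hk => hy k (by omega), hvx _ fun s hs => ?_⟩⟩
      have := hy n (by omega) s hs
      simp only [IdealSpace.charFun, hiter, this]
  -- The visit patterns of all `s ∈ S` together determine a member of the `n`-th join containing the
  -- point.
  have hcomp : ∀ n, complexity (iterJoin f U n) ≤
      ∏ s : S, (visitPatterns (F : A →+* A) (s : A) n).card := by
    intro n
    rw [← Fintype.card_piFinset]
    refine complexity_le_card_of_refines
      (fun x (s : S) => (Finset.range n).filter ((F : A →+* A)^[·] (s : A) ∈ ι x)) (fun x => ?_)
      fun x => ?_
    · exact Fintype.mem_piFinset.2 fun s => Finset.mem_filter.2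
        ⟨Finset.mem_powerset.2 (Finset.filter_subset _ _), ι x, by congr⟩
    · obtain ⟨u, hu, hux⟩ := hjoin n x
      refine ⟨u, hu, fun y hy => hux y fun k hk s hs => ?_⟩
      have h := Finset.ext_iff.1 (congrFun hy ⟨s, hs⟩) k
      rw [Finset.mem_filter, Finset.mem_filter] at h
      exact (and_congr_right_iff.1 h) (Finset.mem_range.2 hk)
  have hbound : ∀ n : ℕ, Real.log (complexity (iterJoin f U n)) / n ≤
      ∑ s : S, Real.log (visitPatterns (F : A →+* A) (s : A) n).card / n := by
    intro n
    rw [← Finset.sum_div]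
    refine div_le_div_of_nonneg_right ?_ n.cast_nonneg
    -- Complexity zero occurs only for empty `X`, where `Real.log 0 = 0`.
    rcases Nat.eq_zero_or_pos (complexity (iterJoin f U n)) with h0 | h0
    · rw [h0, Nat.cast_zero, Real.log_zero]
      exact Finset.sum_nonneg fun _ _ => Real.log_natCast_nonneg _
    · have hne : ∀ s ∈ Finset.univ, (visitPatterns (F : A →+* A) ((s : S) : A) n).card ≠ 0 :=
        Finset.prod_ne_zero_iff.1 (h0.trans_le (hcomp n)).ne'
      rw [← Real.log_prod fun s hs => Nat.cast_ne_zero.2 (hne s hs)]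
      exact Real.log_le_log (by exact_mod_cast h0) (by exact_mod_cast hcomp n)
  have hlim : Tendsto (fun n : ℕ => Real.log (complexity (iterJoin f U n)) / n) atTop (𝓝 0) := by
    refine squeeze_zero (fun n => div_nonneg (Real.log_natCast_nonneg _) n.cast_nonneg) hbound ?_
    simpa using tendsto_finsetSum Finset.univ fun (s : S) _ =>
      tendsto_log_card_visitPatterns F (s : A)
  exact ((continuous_coe_real_ereal.tendsto _).comp hlim).limsup_eq

end CoverEntropy

/-! ### Compactness and comparison of topologies -/

namespace IdealSpace

/-- The limit of a family of ideals along an ultrafilter. -/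
def ultrafilterLimit {A X : Type*} [CommRing A] (ι : X → Ideal A) (𝓤 : Ultrafilter X) :
    Ideal A where
  carrier := {a | ∀ᶠ x in (𝓤 : Filter X), a ∈ ι x}
  add_mem' ha hb := (ha.and hb).mono fun _ h => add_mem h.1 h.2
  zero_mem' := Eventually.of_forall fun x => (ι x).zero_mem
  smul_mem' c _ ha := ha.mono fun x h => (ι x).mul_mem_left c h

theorem mem_ultrafilterLimit {A X : Type*} [CommRing A] {ι : X → Ideal A} {𝓤 : Ultrafilter X}
    {a : A} : a ∈ ultrafilterLimit ι 𝓤 ↔ ∀ᶠ x in (𝓤 : Filter X), a ∈ ι x := Iff.rfl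

/-- An ultrafilter decides each membership `a ∈ ι x`, so every coordinate converges to that of the
limit ideal; only the realization of this ideal by a point is at stake. -/
theorem compactSpace_of_ultrafilterLimit {A X : Type*} [CommRing A] (ι : X → Ideal A)
    (h : ∀ 𝓤 : Ultrafilter X, ∃ x, ι x = ultrafilterLimit ι 𝓤) :
    @CompactSpace X (TopologicalSpace.induced (fun x => charFun (ι x)) inferInstance) := by
  let _ : TopologicalSpace X := TopologicalSpace.induced (fun x => charFun (ι x)) inferInstance
  refine ⟨isCompact_iff_ultrafilter_le_nhds.2 fun 𝓤 _ => ?_⟩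
  obtain ⟨x, hx⟩ := h 𝓤
  refine ⟨x, mem_univ x, ?_⟩
  rw [nhds_induced, ← tendsto_iff_comap, tendsto_pi_nhds]
  intro a
  rw [nhds_discrete, tendsto_pure]
  by_cases ha : a ∈ ι x
  · refine (mem_ultrafilterLimit.1 (hx ▸ ha)).mono fun y hy => ?_
    simp [charFun, ha, hy]
  · have : ∀ᶠ y in (𝓤 : Filter X), a ∉ ι y :=
      Ultrafilter.eventually_not.2 fun h' => ha (hx ▸ mem_ultrafilterLimit.2 h')
    refine this.mono fun y hy => ?_
    simp [charFun, ha, hy]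

theorem compactSpace_constructible (A : Type*) [CommRing A] :
    @CompactSpace (Id A) (constructible A) := by
  refine compactSpace_of_ultrafilterLimit (fun I : Id A => I.1) fun 𝓤 =>
    ⟨⟨ultrafilterLimit (fun I : Id A => I.1) 𝓤, ?_⟩, rfl⟩
  rw [Ne, Ideal.eq_top_iff_one, mem_ultrafilterLimit, ← Ultrafilter.eventually_not]
  exact Eventually.of_forall fun I => (Ideal.ne_top_iff_one _).1 I.2

theorem compactSpace_specConstructible (A : Type*) [CommRing A] :
    @CompactSpace (PrimeSpectrum A) (specConstructible A) := by
  refine compactSpace_of_ultrafilterLimit (fun p : PrimeSpectrum A => p.asIdeal)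
    fun 𝓤 => ⟨⟨ultrafilterLimit (fun p : PrimeSpectrum A => p.asIdeal) 𝓤,
      ⟨?_, fun {a b} hab => ?_⟩⟩, rfl⟩
  · rw [Ne, Ideal.eq_top_iff_one, mem_ultrafilterLimit, ← Ultrafilter.eventually_not]
    exact Eventually.of_forall fun p => (Ideal.ne_top_iff_one _).1 p.2.ne_top
  -- Primality survives because an ultrafilter splits disjunctions.
  · exact Ultrafilter.eventually_or.1
      ((mem_ultrafilterLimit.1 hab).mono fun p hp => p.2.mem_or_mem hp)

theorem isOpen_setOf_notMem {A X : Type*} [CommRing A] (ι : X → Ideal A) (a : A) :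
    IsOpen[TopologicalSpace.induced (fun x => charFun (ι x)) inferInstance] {x | a ∉ ι x} := by
  refine isOpen_induced_iff.2 ⟨(fun φ => φ a) ⁻¹' {false},
    (isOpen_discrete _).preimage (continuous_apply a), ?_⟩
  ext x
  simp [charFun]

theorem constructible_le_zariski (A : Type*) [CommRing A] : constructible A ≤ zariski A := by
  refine le_generateFrom ?_
  rintro _ ⟨a, rfl⟩
  exact isOpen_setOf_notMem (fun I : Id A => I.1) a

theorem specConstructible_le_zariski (A : Type*) [CommRing A] :
    specConstructible A ≤ PrimeSpectrum.zariskiTopology := by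
  rw [PrimeSpectrum.isTopologicalBasis_basic_opens.eq_generateFrom]
  refine le_generateFrom ?_
  rintro _ ⟨a, rfl⟩
  exact isOpen_setOf_notMem (fun p : PrimeSpectrum A => p.asIdeal) a

end IdealSpace

/-! ### The four entropies -/

theorem mainTheorem8 {R : Type*} [CommRing R] {A : Type*} [CommRing A] [Algebra R A]
    [Algebra.FiniteType R A] (F : A →ₐ[R] A) :
    CoverEntropy.topologicalEntropy (IdealSpace.constructible A)
        (IdealSpace.comap (F : A →+* A)) = 0 ∧
      CoverEntropy.topologicalEntropy (IdealSpace.zariski A)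
        (IdealSpace.comap (F : A →+* A)) = 0 ∧
      CoverEntropy.topologicalEntropy (constructibleTopology (PrimeSpectrum A))
        (PrimeSpectrum.comap (F : A →+* A)) = 0 ∧
      CoverEntropy.topologicalEntropy (PrimeSpectrum.zariskiTopology (R := A))
        (PrimeSpectrum.comap (F : A →+* A)) = 0 := by
  have hId : ∀ U, CoverEntropy.IsFiniteOpenCover (IdealSpace.constructible A) U →
      CoverEntropy.coverEntropy (IdealSpace.comap (F : A →+* A)) U = 0 := fun U hU =>
    CoverEntropy.coverEntropy_eq_zero_of_ideals F (fun I : IdealSpace.Id A => I.1) _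
      (fun _ => rfl) (IdealSpace.compactSpace_constructible A) hU
  have hSpec : ∀ U, CoverEntropy.IsFiniteOpenCover (IdealSpace.specConstructible A) U →
      CoverEntropy.coverEntropy (PrimeSpectrum.comap (F : A →+* A)) U = 0 := fun U hU =>
    CoverEntropy.coverEntropy_eq_zero_of_ideals F (fun p : PrimeSpectrum A => p.asIdeal) _
      (fun _ => rfl) (IdealSpace.compactSpace_specConstructible A) hU
  rw [IdealSpace.constructibleTopology_primeSpectrum]
  exact ⟨CoverEntropy.topologicalEntropy_eq_zero hId,
    -- A Zariski-open cover is also open for the finer constructible topology.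
    CoverEntropy.topologicalEntropy_eq_zero fun U hU =>
      hId U (hU.mono (IdealSpace.constructible_le_zariski A)),
    CoverEntropy.topologicalEntropy_eq_zero hSpec,
    CoverEntropy.topologicalEntropy_eq_zero fun U hU =>
      hSpec U (hU.mono (IdealSpace.specConstructible_le_zariski A))⟩
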